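/- Let $k$ be a field of characteristic zero, $T = k[[X_1,\ldots,X_d]]$, $n \ge 1$, let $f_1,\ldots,f_d$ be a system of parameters of $T$, $\mathfrak{d} = (f_1,\ldots,f_d)$ and $l = f_1+\cdots+f_d$. For an integer $s\ge 0$ put $\mathfrak{c}_{n,s} = (f_1^n,\ldots,f_d^n) :_T l^s$. An ideal $\mathfrak{c}$ of $T$ is called Gorenstein if $T/\mathfrak{c}$ is a Gorenstein local ring; ideals $I, J$ are directly linked via a Gorenstein ideal $\mathfrak{c}$ if $\mathfrak{c} \subseteq I \cap J$, $\mathfrak{c}:_T I = J$ and $\mathfrak{c}:_T J = I$; and $I$ is linked to $J$ in $m$ steps if there are ideals $I = \mathfrak{b}_0, \mathfrak{b}_1, \ldots, \mathfrak{b}_m = J$ such that each $\mathfrak{b}_i$ is directly linked to $\mathfrak{b}_{i+1}$ via some Gorenstein ideal. (1) For every integer $s \ge 0$ with $s \ge (d-2)(n-1)-1$ we have $\mathfrak{c}_{n,s} :_T \mathfrak{d}^n = \mathfrak{d}^{(d-1)(n-1)-s}$, where a power of $\mathfrak{d}$ with negative exponent is understood to be $T$; and if moreover $s \le d(n-1)$,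 then $\mathfrak{c}_{n,s}$ is a Gorenstein ideal. (2) If $s = (d-2)(n-1)$ is non-negative, then $\mathfrak{d}^n$ is directly linked to $\mathfrak{d}^{n-1}$ via the Gorenstein ideal $\mathfrak{c}_{n,s}$. Hence, if $d \ge 2$, $\mathfrak{d}^n$ is linked to $\mathfrak{d}$ via Gorenstein ideals in $n-1$ steps. (3) If $s = (d-2)(n-1)-1$ is non-negative, then $\mathfrak{d}^n$ is directly linked to itself via the Gorenstein ideal $\mathfrak{c}_{n,s}$. -/

import Mathlib

/-- A system of parameters of a local ring `R`: as many elements as the Krull dimension of `R`,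
generating an ideal that is primary to the maximal ideal (its radical is the maximal ideal). -/
def IsSystemOfParameters {R : Type*} [CommRing R] [IsLocalRing R] {d : ℕ} (f : Fin d → R) : Prop :=
  ringKrullDim R = d ∧ (Ideal.span (Set.range f)).radical = IsLocalRing.maximalIdeal R

/-- A Gorenstein local ring: a Noetherian local ring of finite injective dimension over itself. -/
def IsGorensteinLocalRing.{u} (R : Type u) [CommRing R] : Prop :=
  IsNoetherianRing R ∧ IsLocalRing R ∧ CategoryTheory.injectiveDimension (ModuleCat.of R R) < ⊤

/-- `I` is a Gorenstein ideal of `T`: the quotient `T ⧸ I` is a Gorenstein local ring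
(in particular `I` is a proper ideal). -/
def IsGorensteinIdeal.{u} {T : Type u} [CommRing T] (I : Ideal T) : Prop :=
  IsGorensteinLocalRing (T ⧸ I)

/-- `I` and `J` are directly linked via the Gorenstein ideal `c`. -/
structure IsDirectlyLinkedVia.{u} {T : Type u} [CommRing T] (c I J : Ideal T) : Prop where
  gorenstein : IsGorensteinIdeal c
  le_left : c ≤ I
  le_right : c ≤ J
  colon_left : c.colon (I : Set T) = J
  colon_right : c.colon (J : Set T) = I

/-- `I` is linked to `J` via Gorenstein ideals in `m` steps. -/
def IsGorensteinLinkedInSteps.{u} {T : Type u} [CommRing T] (m : ℕ) (I J : Ideal T) : Prop :=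
  ∃ b : ℕ → Ideal T, b 0 = I ∧ b m = J ∧
    ∀ i < m, ∃ c : Ideal T, IsDirectlyLinkedVia c (b i) (b (i + 1))

/-- The ideal `(f₁ⁿ, …, f_dⁿ) : lˢ`, where `l = f₁ + ⋯ + f_d`. -/
def powerColon {T : Type*} [CommRing T] {d : ℕ} (f : Fin d → T) (n s : ℕ) : Ideal T :=
  (Ideal.span (Set.range fun i => f i ^ n)).colon {(∑ i, f i) ^ s}

/-! Put n = m + 1, q = (f₁ⁿ, …, f_dⁿ) and c = q : lˢ. Powers of the fᵢ form regular sequences in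
every order, so modulo q the fᵢ behave like variables over T/D truncated at exponent m: D^(dm+1) ⊆ q
and q : ∏ fᵢ^m = D.

The links come from c : D^e = D^j for j + s + e = dm + 1, j ≤ m + 1 and dm ≤ s + 2e. The inclusion ⊇
is a degree count. For ⊆, let g = p(f) lie in the left side, with p a form of degree i < j.
Multiplying lˢg by monomials of complementary degree dm - s - i ≥ e shows that (∑ Xⱼ)ˢp has
coefficients in D at all exponents ≤ m. Since T/D contains a field of characteristic zero and 2i + s
≤ dm, the strong Lefschetz property of (T/D)[X]/(Xⱼ^(m+1)), proved with an sl₂ lowering operator,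
kills p modulo D; hence g ∈ D^(i+1) (`mem_span_pow_succ_of_forall_mul_mem`).

For the Gorenstein property, q is the set of x with Φ(xT) = 0 for some functional Φ
(`MvPowerSeries.exists_functional`). Then Φ(lˢ ·) defines c in the same way, and a
finite-dimensional algebra with such a functional is self-injective. Φ exists because the socle of
T/q is principal: Ext^d(k, T) is cyclic, and dividing by a regular sequence shifts Ext down to
Hom(k, T/q). -/

namespace MvPolynomial

/-! ### The strong Lefschetz property via sl₂ -/

variable {σ R : Type*} [CommRing R]

theorem mem_span_X_pow_iff (m : ℕ) (p : MvPolynomial σ R) :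
    p ∈ Ideal.span (Set.range fun j : σ => (X j : MvPolynomial σ R) ^ (m + 1)) ↔
      ∀ a : σ →₀ ℕ, (∀ j, a j ≤ m) → coeff a p = 0 := by
  have h : (Set.range fun j : σ => (X j : MvPolynomial σ R) ^ (m + 1)) =
      (fun s => monomial s (1 : R)) '' (Set.range fun j : σ => Finsupp.single j (m + 1)) := by
    rw [← Set.range_comp]
    congr 1
    ext1 j
    simp [X_pow_eq_monomial]
  rw [h, mem_ideal_span_monomial_image]
  simp only [Set.mem_range, exists_exists_eq_and, Finsupp.single_le_iff, mem_support_iff]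
  constructor
  · intro H a ha
    by_contra hne
    obtain ⟨j, hj⟩ := H a hne
    have := ha j
    omega
  · intro H a ha
    by_contra! hne
    exact ha (H a fun j => by have := hne j; omega)

variable [Fintype σ]

/-- The lowering operator `∑ⱼ (m ∂ⱼ - Xⱼ ∂ⱼ²)` of the `sl₂`-action on
`R[X] ⧸ (Xⱼ ^ (m + 1))` whose raising operator is multiplication by `∑ⱼ Xⱼ`. -/
noncomputable def lowering (m : ℕ) (p : MvPolynomial σ R) : MvPolynomial σ R :=
  ∑ j, ((m : MvPolynomial σ R) * pderiv j p - X j * pderiv j (pderiv j p))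

/-- In the variable Xⱼ the operator sends X^a to a(m + 1 - a)X^(a-1). The factor vanishes at a = m +
1, so the operator descends to the quotient. -/
theorem lowering_mem_span_X_pow (m : ℕ) {p : MvPolynomial σ R}
    (hp : p ∈ Ideal.span (Set.range fun j : σ => (X j : MvPolynomial σ R) ^ (m + 1))) :
    lowering m p ∈ Ideal.span (Set.range fun j : σ => (X j : MvPolynomial σ R) ^ (m + 1)) := by
  classical
  rw [mem_span_X_pow_iff] at hp ⊢
  intro a ha
  rw [lowering, coeff_sum]
  refine Finset.sum_eq_zero fun j _ => ?_
  have key : coeff a ((m : MvPolynomial σ R) * pderiv j p - X j * pderiv j (pderiv j p)) =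
      (((m : R) - a j) * (a j + 1)) * coeff (a + Finsupp.single j 1) p := by
    have h1 : coeff a ((m : MvPolynomial σ R) * pderiv j p) = m * coeff a (pderiv j p) := by
      rw [← map_natCast (C : R →+* MvPolynomial σ R), coeff_C_mul]
    rw [coeff_sub, h1, coeff_X_mul', coeff_pderiv]
    split_ifs with h
    · have h2 : a - Finsupp.single j 1 + Finsupp.single j 1 = a := by
        refine tsub_add_cancel_of_le ?_
        rw [Finsupp.single_le_iff]
        exact Nat.one_le_iff_ne_zero.2 (Finsupp.mem_support_iff.1 h)
      have h3 : ((a - Finsupp.single j 1 : σ →₀ ℕ) j : R) + 1 = a j := by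
        conv_rhs => rw [← h2]
        simp
      rw [coeff_pderiv, h2, h3, coeff_pderiv]
      ring
    · have : a j = 0 := by simpa using h
      rw [this]
      push_cast
      ring
  rw [key]
  rcases (ha j).lt_or_eq with h | h
  · rw [hp, mul_zero]
    intro i
    by_cases hij : j = i
    · subst hij
      simpa using h
    · simpa [Finsupp.single_apply, hij] using ha i
  · simp [h]

/-- The commutator with ∑ Xⱼ is ∑ⱼ (m - 2Xⱼ∂ⱼ), which Euler's identity evaluates on forms of degree
i. -/
theorem lowering_sum_X_mul (m i : ℕ) {p : MvPolynomial σ R} (hp : p.IsHomogeneous i) :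
    lowering m ((∑ j, X j) * p) = (∑ j, X j) * lowering m p +
      ((Fintype.card σ * m - 2 * i : ℤ) : MvPolynomial σ R) * p := by
  classical
  have hL (j : σ) : pderiv j (∑ i, X i : MvPolynomial σ R) = 1 := by
    rw [map_sum, Finset.sum_eq_single j] <;> simp +contextual
  have hE := hp.sum_X_mul_pderiv
  rw [nsmul_eq_mul] at hE
  have h1 (j : σ) : (m : MvPolynomial σ R) * pderiv j ((∑ i, X i) * p) -
      X j * pderiv j (pderiv j ((∑ i, X i) * p)) =
      (∑ i, X i) * ((m : MvPolynomial σ R) * pderiv j p - X j * pderiv j (pderiv j p)) +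
      ((m : MvPolynomial σ R) * p - 2 * (X j * pderiv j p)) := by
    simp only [pderiv_mul, hL, map_add, one_mul]
    ring
  simp only [lowering, h1]
  rw [Finset.sum_add_distrib, ← Finset.mul_sum]
  congr 1
  rw [Finset.sum_sub_distrib, ← Finset.mul_sum, ← Finset.mul_sum, hE, Finset.sum_const,
    Finset.card_univ, nsmul_eq_mul]
  push_cast
  ring

/-- The constant is the sum of the weights dm - 2(i + r) over 0 ≤ r ≤ s, where d is the number of
variables. -/
theorem lowering_sum_X_pow_mul (m i s : ℕ) {p : MvPolynomial σ R} (hp : p.IsHomogeneous i) :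
    lowering m ((∑ j, X j) ^ (s + 1) * p) = (∑ j, X j) ^ (s + 1) * lowering m p +
      (((s + 1) * (Fintype.card σ * m - 2 * i - s) : ℤ) : MvPolynomial σ R) *
        ((∑ j, X j) ^ s * p) := by
  induction s with
  | zero => simp [lowering_sum_X_mul m i hp]
  | succ s ih =>
    have hL : (∑ j, X j : MvPolynomial σ R).IsHomogeneous 1 :=
      IsHomogeneous.sum _ _ _ fun j _ => isHomogeneous_X R j
    have h := lowering_sum_X_mul m ((s + 1) + i) (p := (∑ j, X j) ^ (s + 1) * p)
      (by simpa using (hL.pow (s + 1)).mul hp)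
    rw [pow_succ' _ (s + 1), mul_assoc, h, ih]
    push_cast
    ring

theorem lowering_eq_zero_of_isHomogeneous_zero (m : ℕ) {p : MvPolynomial σ R}
    (hp : p.IsHomogeneous 0) : lowering m p = 0 := by
  rw [← totalDegree_zero_iff_isHomogeneous, totalDegree_eq_zero_iff_eq_C] at hp
  rw [hp]
  simp [lowering]

theorem isHomogeneous_lowering (m i : ℕ) {p : MvPolynomial σ R}
    (hp : p.IsHomogeneous (i + 1)) : (lowering m p).IsHomogeneous i := by
  have h (j : σ) : (pderiv j p).IsHomogeneous i := by simpa using hp.pderiv (i := j)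
  refine IsHomogeneous.sum _ _ _ fun j _ => IsHomogeneous.sub ?_ ?_
  · have := (isHomogeneous_C σ (m : R)).mul (h j)
    simpa using this
  · cases i with
    | zero =>
      have h0 := h j
      rw [← totalDegree_zero_iff_isHomogeneous, totalDegree_eq_zero_iff_eq_C] at h0
      rw [h0]
      simpa using isHomogeneous_zero σ R 0
    | succ i =>
      have h2 : (pderiv j (pderiv j p)).IsHomogeneous i := by simpa using (h j).pderiv (i := j)
      simpa [add_comm] using (isHomogeneous_X R j).mul h2

/-- Injectivity part of the strong Lefschetz property of monomial complete intersections. -/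
theorem mem_span_X_pow_of_sum_X_pow_mul_mem [IsAddTorsionFree R] (m i s : ℕ)
    {p : MvPolynomial σ R} (hp : p.IsHomogeneous i) (hs : 2 * i + s ≤ Fintype.card σ * m)
    (h : (∑ j, X j) ^ s * p ∈
      Ideal.span (Set.range fun j : σ => (X j : MvPolynomial σ R) ^ (m + 1))) :
    p ∈ Ideal.span (Set.range fun j : σ => (X j : MvPolynomial σ R) ^ (m + 1)) := by
  induction i generalizing s p with
  | zero =>
    induction s with
    | zero => simpa using h
    | succ s ih =>
      refine ih (by omega) ?_
      have h1 := lowering_mem_span_X_pow m h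
      rw [lowering_sum_X_pow_mul m 0 s hp, lowering_eq_zero_of_isHomogeneous_zero m hp, mul_zero,
        zero_add] at h1
      obtain ⟨t, ht⟩ := Nat.exists_eq_add_of_le hs
      -- The degree bound makes the constant a positive integer, which torsion-freeness allows to
      -- cancel.
      have e : ((s + 1) * (Fintype.card σ * m - 2 * (0 : ℕ) - s) : ℤ) =
          (((s + 1) * (t + 1) : ℕ) : ℤ) := by
        push_cast
        rw [← Nat.cast_mul, ht]
        push_cast
        ring
      rw [e] at h1
      rw [mem_span_X_pow_iff] at h1 ⊢
      intro a ha
      have h2 := h1 a ha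
      rw [Int.cast_natCast, ← nsmul_eq_mul, coeff_smul] at h2
      exact (nsmul_eq_zero_iff_right (by positivity)).1 h2
  | succ i ih0 =>
    induction s with
    | zero => simpa using h
    | succ s ih =>
      refine ih (by omega) ?_
      have h1 := lowering_mem_span_X_pow m h
      rw [lowering_sum_X_pow_mul m (i + 1) s hp] at h1
      -- Multiplying `h1` by ∑ Xⱼ turns its second term into a multiple of `h`. What remains
      -- concerns a form of degree one less with s + 2 in place of s + 1, so the bound is preserved.
      have h3 : lowering m p ∈
          Ideal.span (Set.range fun j : σ => (X j : MvPolynomial σ R) ^ (m + 1)) := by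
        refine ih0 (s + 2) (isHomogeneous_lowering m i hp) (by omega) ?_
        have h4 := Ideal.sub_mem _ (Ideal.mul_mem_left _ (∑ j, X j) h1)
          (Ideal.mul_mem_left _ (((s + 1) * (Fintype.card σ * m - 2 * (i + 1 : ℕ) - s) : ℤ) :
            MvPolynomial σ R) h)
        convert h4 using 1
        ring
      have h5 := Ideal.sub_mem _ h1 (Ideal.mul_mem_left _ ((∑ j, X j) ^ (s + 1)) h3)
      rw [add_sub_cancel_left] at h5
      obtain ⟨t, ht⟩ := Nat.exists_eq_add_of_le hs
      have e : ((s + 1) * (Fintype.card σ * m - 2 * (i + 1 : ℕ) - s) : ℤ) =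
          (((s + 1) * (t + 1) : ℕ) : ℤ) := by
        push_cast
        rw [← Nat.cast_mul, ht]
        push_cast
        ring
      rw [e] at h5
      rw [mem_span_X_pow_iff] at h5 ⊢
      intro a ha
      have h2 := h5 a ha
      rw [Int.cast_natCast, ← nsmul_eq_mul, coeff_smul] at h2
      exact (nsmul_eq_zero_iff_right (by positivity)).1 h2

end MvPolynomial

/-! ### Depth and type through Ext from the residue field -/

section DepthAndType

open CategoryTheory Abelian IsLocalRing

universe u

variable {R : Type u} [CommRing R]

/-- The complex `R ⧸ I → R ⧸ I → R ⧸ (I + (x))` whose first map is multiplication by `x`. -/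
noncomputable abbrev quotientSmulShortComplex (I : Ideal R) (x : R) : ShortComplex (ModuleCat.{u} R) :=
  ShortComplex.mk (X₁ := ModuleCat.of R (R ⧸ I)) (X₂ := ModuleCat.of R (R ⧸ I))
    (X₃ := ModuleCat.of R (R ⧸ (I ⊔ Ideal.span {x})))
    (x • 𝟙 _) (ModuleCat.ofHom (Submodule.factor (le_sup_left : I ≤ I ⊔ Ideal.span {x}))) (by
      refine ModuleCat.hom_ext (LinearMap.ext fun y => ?_)
      obtain ⟨y, rfl⟩ := Submodule.mkQ_surjective _ y
      change (I ⊔ Ideal.span {x}).mkQ (x • y) = 0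
      rw [Submodule.mkQ_apply, Submodule.Quotient.mk_eq_zero, smul_eq_mul]
      exact Ideal.mul_mem_right _ _ (Ideal.mem_sup_right (Ideal.mem_span_singleton_self x)))

theorem quotientSmulShortComplex_shortExact {I : Ideal R} {x : R}
    (hx : ∀ c, c * x ∈ I → c ∈ I) : (quotientSmulShortComplex I x).ShortExact where
  exact := by
    rw [ShortComplex.moduleCat_exact_iff]
    intro y hy
    obtain ⟨y, rfl⟩ := Submodule.mkQ_surjective _ y
    change (I ⊔ Ideal.span {x}).mkQ y = 0 at hy
    rw [Submodule.mkQ_apply, Submodule.Quotient.mk_eq_zero, Submodule.mem_sup] at hy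
    obtain ⟨a, ha, b, hb, rfl⟩ := hy
    obtain ⟨c, rfl⟩ := Ideal.mem_span_singleton'.1 hb
    refine ⟨I.mkQ c, ?_⟩
    change x • I.mkQ c = I.mkQ (a + c * x)
    have h0 : I.mkQ a = 0 := (Submodule.Quotient.mk_eq_zero I).2 ha
    rw [map_add, h0, zero_add, ← map_smul, smul_eq_mul, mul_comm]
  mono_f := by
    rw [ModuleCat.mono_iff_injective, injective_iff_map_eq_zero]
    intro y hy
    obtain ⟨y, rfl⟩ := Submodule.mkQ_surjective _ y
    change x • I.mkQ y = 0 at hy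
    rw [← map_smul, Submodule.mkQ_apply, Submodule.Quotient.mk_eq_zero, smul_eq_mul, mul_comm] at hy
    exact (Submodule.Quotient.mk_eq_zero I).2 (hx _ hy)
  epi_g := by
    rw [ModuleCat.epi_iff_surjective]
    exact Submodule.factor_surjective (le_sup_left : I ≤ I ⊔ Ideal.span {x})

variable [IsLocalRing R]

/-- `Ext` from the residue field to `R ⧸ I`. -/
abbrev ResidueExt (I : Ideal R) (i : ℕ) : Type u :=
  Ext (ModuleCat.of R (R ⧸ maximalIdeal R)) (ModuleCat.of R (R ⧸ I)) i

/-- The module `R ⧸ I` has depth at least `t`. -/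
def QuotientDepthGE (I : Ideal R) (t : ℕ) : Prop :=
  ∀ i < t, Subsingleton (ResidueExt I i)

/-- The `t`-th `Ext` of the residue field with values in `R ⧸ I` is cyclic. -/
def CyclicResidueExt (I : Ideal R) (t : ℕ) : Prop :=
  ∃ e : ResidueExt I t, ∀ ξ, ∃ r : R, ξ = r • e

/-- Scalars may be moved to the first argument of Ext, where x acts as zero. -/
theorem smul_residueExt_eq_zero {I : Ideal R} {x : R} (hx : x ∈ maximalIdeal R) {i : ℕ}
    (ξ : ResidueExt I i) : x • ξ = 0 := by
  have h : x • 𝟙 (ModuleCat.of R (R ⧸ maximalIdeal R)) = 0 := by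
    refine ModuleCat.hom_ext (LinearMap.ext fun y => ?_)
    obtain ⟨y, rfl⟩ := Submodule.mkQ_surjective _ y
    change x • (maximalIdeal R).mkQ y = 0
    rw [← map_smul, Submodule.mkQ_apply, Submodule.Quotient.mk_eq_zero]
    exact Ideal.mul_mem_right _ _ hx
  have : x • ξ = (Ext.mk₀ (x • 𝟙 (ModuleCat.of R (R ⧸ maximalIdeal R)))).comp ξ (zero_add i) := by
    simp [Ext.mk₀_smul]
  rw [this, h]
  simp

/-- The connecting map of the long exact sequence attached to multiplication by `x`. -/
noncomputable def residueExtConnecting {I : Ideal R} {x : R} (hreg : ∀ c, c * x ∈ I → c ∈ I)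
    (i : ℕ) : ResidueExt (I ⊔ Ideal.span {x}) i →ₗ[R] ResidueExt I (i + 1) where
  toFun ζ := ζ.comp (quotientSmulShortComplex_shortExact hreg).extClass rfl
  map_add' _ _ := Ext.add_comp _ _ _ _
  map_smul' _ _ := Ext.smul_comp _ _ _ _

/-- The next map in the long exact sequence is multiplication by x, which is zero. -/
theorem residueExtConnecting_surjective {I : Ideal R} {x : R} (hx : x ∈ maximalIdeal R)
    (hreg : ∀ c, c * x ∈ I → c ∈ I) (i : ℕ) :
    Function.Surjective (residueExtConnecting hreg i) := by
  intro ξ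
  refine Ext.covariant_sequence_exact₁ _ (quotientSmulShortComplex_shortExact hreg) ξ ?_ rfl
  rw [Ext.mk₀_smul, Ext.comp_smul]
  exact (congrArg _ (Ext.comp_mk₀_id ξ)).trans (smul_residueExt_eq_zero hx ξ)

theorem residueExtConnecting_injective {I : Ideal R} {x : R}
    (hreg : ∀ c, c * x ∈ I → c ∈ I) {i : ℕ} (hI : Subsingleton (ResidueExt I i)) :
    Function.Injective (residueExtConnecting hreg i) := by
  rw [injective_iff_map_eq_zero]
  intro ζ h
  obtain ⟨ξ, rfl⟩ :=
    Ext.covariant_sequence_exact₃ _ (quotientSmulShortComplex_shortExact hreg) ζ rfl h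
  exact (congrArg (fun ξ => Ext.comp ξ _ (add_zero i)) (hI.elim ξ 0)).trans (Ext.zero_comp _ _ _ _ _)

theorem QuotientDepthGE.sup_span_singleton {I : Ideal R} {t : ℕ} (h : QuotientDepthGE I (t + 1))
    {x : R} (hreg : ∀ c, c * x ∈ I → c ∈ I) :
    QuotientDepthGE (I ⊔ Ideal.span {x}) t := by
  intro i hi
  have := h (i + 1) (by omega)
  exact (residueExtConnecting_injective hreg (h i (by omega))).subsingleton

theorem QuotientDepthGE.of_sup_span_singleton {I : Ideal R} {t : ℕ} {x : R}
    (hx : x ∈ maximalIdeal R) (hreg : ∀ c, c * x ∈ I → c ∈ I)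
    (h : QuotientDepthGE (I ⊔ Ideal.span {x}) t) : QuotientDepthGE I (t + 1) := by
  intro i hi
  refine subsingleton_of_forall_eq 0 fun ξ => ?_
  cases i with
  | zero =>
    -- In degree 0 the class is a homomorphism killed by x, while x is regular on its target.
    have h0 := smul_residueExt_eq_zero hx ξ
    obtain ⟨g, rfl⟩ := Ext.linearEquiv₀ (R := R).symm.surjective ξ
    rw [← map_smul, LinearEquiv.map_eq_zero_iff] at h0
    rw [LinearEquiv.map_eq_zero_iff]
    refine ModuleCat.hom_ext (LinearMap.ext fun y => ?_)
    have h1 : x • g.hom y = 0 := congrArg (fun g => g.hom y) h0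
    change g.hom y = 0
    generalize g.hom y = z at h1
    obtain ⟨z, rfl⟩ := Submodule.mkQ_surjective _ z
    rw [← map_smul, Submodule.mkQ_apply, Submodule.Quotient.mk_eq_zero, smul_eq_mul, mul_comm] at h1
    exact (Submodule.Quotient.mk_eq_zero I).2 (hreg _ h1)
  | succ i =>
    obtain ⟨ζ, rfl⟩ := residueExtConnecting_surjective hx hreg i ξ
    rw [(h i (by omega)).elim ζ 0, map_zero]

theorem CyclicResidueExt.sup_span_singleton {I : Ideal R} {t : ℕ}
    (h : CyclicResidueExt I (t + 1)) (hd : QuotientDepthGE I (t + 1))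
    {x : R} (hx : x ∈ maximalIdeal R) (hreg : ∀ c, c * x ∈ I → c ∈ I) :
    CyclicResidueExt (I ⊔ Ideal.span {x}) t := by
  obtain ⟨e, he⟩ := h
  obtain ⟨e', rfl⟩ := residueExtConnecting_surjective hx hreg t e
  refine ⟨e', fun ζ => ?_⟩
  obtain ⟨r, hr⟩ := he (residueExtConnecting hreg t ζ)
  refine ⟨r, residueExtConnecting_injective hreg (hd t (by omega)) ?_⟩
  rw [hr, map_smul]

theorem CyclicResidueExt.of_sup_span_singleton {I : Ideal R} {t : ℕ} {x : R}
    (hx : x ∈ maximalIdeal R) (hreg : ∀ c, c * x ∈ I → c ∈ I)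
    (h : CyclicResidueExt (I ⊔ Ideal.span {x}) t) : CyclicResidueExt I (t + 1) := by
  obtain ⟨e, he⟩ := h
  refine ⟨residueExtConnecting hreg t e, fun ξ => ?_⟩
  obtain ⟨ζ, rfl⟩ := residueExtConnecting_surjective hx hreg t ξ
  obtain ⟨r, rfl⟩ := he ζ
  exact ⟨r, map_smul _ _ _⟩

/-- A cyclic `Hom` from the residue field means that the socle is principal. -/
theorem CyclicResidueExt.exists_socle_generator {I : Ideal R} (h : CyclicResidueExt I 0) :
    ∃ σ : R, (∀ x ∈ maximalIdeal R, x * σ ∈ I) ∧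
      ∀ z : R, (∀ x ∈ maximalIdeal R, x * z ∈ I) → ∃ r, z - r * σ ∈ I := by
  obtain ⟨e, he⟩ := h
  obtain ⟨σ, hσ⟩ := Submodule.mkQ_surjective I
    ((Ext.linearEquiv₀ (R := R) e).hom ((maximalIdeal R).mkQ 1))
  refine ⟨σ, fun x hx => ?_, fun z hz => ?_⟩
  · have h0 : x • (maximalIdeal R).mkQ 1 = 0 := by
      rw [← map_smul, Submodule.mkQ_apply, Submodule.Quotient.mk_eq_zero, smul_eq_mul, mul_one]
      exact hx
    rw [← Submodule.Quotient.mk_eq_zero, ← smul_eq_mul, ← Submodule.mkQ_apply, map_smul, hσ]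
    exact (map_smul _ _ _).symm.trans ((congrArg _ h0).trans (map_zero _))
  have hk : maximalIdeal R ≤ LinearMap.ker (LinearMap.toSpanSingleton R (R ⧸ I) (I.mkQ z)) := by
    intro x hx
    rw [LinearMap.mem_ker, LinearMap.toSpanSingleton_apply, ← map_smul, Submodule.mkQ_apply,
      Submodule.Quotient.mk_eq_zero]
    exact hz x hx
  obtain ⟨r, hr⟩ := he ((Ext.linearEquiv₀ (R := R)).symm
    (ModuleCat.ofHom ((maximalIdeal R).liftQ _ hk)))
  refine ⟨r, ?_⟩
  have h1 := congrArg (Ext.linearEquiv₀ (R := R)) hr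
  rw [LinearEquiv.apply_symm_apply, map_smul] at h1
  have h2 := congrArg (fun g => g.hom ((maximalIdeal R).mkQ 1)) h1
  have h3 : I.mkQ z = r • I.mkQ σ := by
    rw [hσ]
    refine Eq.trans ?_ h2
    change _ = (maximalIdeal R).liftQ _ hk ((maximalIdeal R).mkQ 1)
    exact (((maximalIdeal R).liftQ_apply _ _).trans (by simp)).symm
  rw [← map_smul, ← sub_eq_zero, ← map_sub, Submodule.mkQ_apply, Submodule.Quotient.mk_eq_zero] at h3
  exact h3

theorem cyclicResidueExt_maximalIdeal : CyclicResidueExt (maximalIdeal R) 0 := by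
  refine ⟨(Ext.linearEquiv₀ (R := R)).symm (𝟙 _), fun ξ => ?_⟩
  obtain ⟨g, rfl⟩ := Ext.linearEquiv₀ (R := R).symm.surjective ξ
  obtain ⟨r, hr⟩ := Submodule.mkQ_surjective (maximalIdeal R) (g.hom ((maximalIdeal R).mkQ 1))
  refine ⟨r, ?_⟩
  rw [← map_smul]
  congr 1
  refine ModuleCat.hom_ext (LinearMap.ext fun y => ?_)
  obtain ⟨y, rfl⟩ := Submodule.mkQ_surjective _ y
  change g.hom ((maximalIdeal R).mkQ y) = r • (maximalIdeal R).mkQ y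
  have : (maximalIdeal R).mkQ y = y • (maximalIdeal R).mkQ 1 := by
    rw [← map_smul, smul_eq_mul, mul_one]
  rw [this, map_smul, ← hr, smul_comm r y, ← map_smul _ r, smul_eq_mul r, mul_one]

end DepthAndType

/-! ### Associated primes and regular sequences -/

section Unmixedness

open IsLocalRing Pointwise

universe u

variable {R : Type u} [CommRing R] [IsNoetherianRing R]

theorem mem_associatedPrimes_quotient_iff {I P : Ideal R} :
    P ∈ associatedPrimes R (R ⧸ I) ↔ P.IsPrime ∧ ∃ a, ∀ r, r ∈ P ↔ r * a ∈ I := by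
  rw [AssociatedPrimes.mem_iff, isAssociatedPrime_iff]
  refine and_congr_right fun _ => ?_
  constructor
  · rintro ⟨a, rfl⟩
    obtain ⟨a, rfl⟩ := Submodule.mkQ_surjective _ a
    refine ⟨a, fun r => ?_⟩
    rw [Submodule.mem_colon_singleton, ← map_smul, Submodule.mem_bot, Submodule.mkQ_apply,
      Submodule.Quotient.mk_eq_zero, smul_eq_mul]
  · rintro ⟨a, ha⟩
    refine ⟨I.mkQ a, ?_⟩
    ext r
    rw [Submodule.mem_colon_singleton, ← map_smul, Submodule.mem_bot, Submodule.mkQ_apply,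
      Submodule.Quotient.mk_eq_zero, smul_eq_mul, ha]

theorem exists_mem_associatedPrimes_of_mul_mem {I : Ideal R} {x c : R} (h : c * x ∈ I)
    (hc : c ∉ I) : ∃ P ∈ associatedPrimes R (R ⧸ I), x ∈ P := by
  have h0 : I.mkQ c ≠ 0 := by
    rwa [Submodule.mkQ_apply, Ne, Submodule.Quotient.mk_eq_zero]
  obtain ⟨P, hP, hle⟩ := exists_le_isAssociatedPrime_of_isNoetherianRing R _ h0
  refine ⟨P, hP, hle ?_⟩
  rwa [Submodule.mem_colon_singleton, ← map_smul, Submodule.mem_bot, Submodule.mkQ_apply,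
    Submodule.Quotient.mk_eq_zero, smul_eq_mul, mul_comm]

theorem le_of_mem_associatedPrimes {I P : Ideal R} (hP : P ∈ associatedPrimes R (R ⧸ I)) :
    I ≤ P := by
  obtain ⟨-, a, ha⟩ := mem_associatedPrimes_quotient_iff.1 hP
  exact fun r hr => (ha r).2 (Ideal.mul_mem_right _ _ hr)

variable [IsLocalRing R]

/-- An associated prime of `R ⧸ I` specializes to an associated prime of `R ⧸ (I + (x))`. -/
theorem exists_mem_associatedPrimes_sup {I P : Ideal R} (hP : P ∈ associatedPrimes R (R ⧸ I))
    {x : R} (hx : x ∈ maximalIdeal R) (hreg : ∀ c, c * x ∈ I → c ∈ I) :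
    ∃ Q ∈ associatedPrimes R (R ⧸ (I ⊔ Ideal.span {x})), P ≤ Q := by
  obtain ⟨hprime, a, ha⟩ := mem_associatedPrimes_quotient_iff.1 hP
  have haI : a ∉ I := fun h => hprime.ne_top <| P.eq_top_iff_one.2 <| (ha 1).2 <| by rwa [one_mul]
  have hpow : ∀ i c, c * x ^ i ∈ I → c ∈ I := by
    intro i
    induction i with
    | zero => simp
    | succ i ih =>
      intro c hc
      exact ih c (hreg _ (by rwa [pow_succ, ← mul_assoc] at hc))
  -- Divide a by x modulo I as often as possible; Krull's intersection theorem makes this stop. As x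
  -- is regular, P still kills the quotient b modulo I, and b survives modulo I + (x).
  have key : ∃ i b, a - b * x ^ i ∈ I ∧ b ∉ I ⊔ Ideal.span {x} := by
    by_contra! H
    have hall : ∀ i, ∃ b, a - b * x ^ i ∈ I := by
      intro i
      induction i with
      | zero => exact ⟨a, by simp⟩
      | succ i ih =>
        obtain ⟨b, hb⟩ := ih
        obtain ⟨u, hu, v, hv, huv⟩ := Submodule.mem_sup.1 (H i b hb)
        obtain ⟨w, rfl⟩ := Ideal.mem_span_singleton'.1 hv
        refine ⟨w, ?_⟩
        have : a - w * x ^ (i + 1) = (a - b * x ^ i) + u * x ^ i := by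
          rw [← huv]
          ring
        rw [this]
        exact I.add_mem hb (I.mul_mem_right _ hu)
    have hne : Ideal.span {x} ≠ ⊤ := fun h =>
      (Ideal.IsPrime.ne_top inferInstance : maximalIdeal R ≠ ⊤)
        (top_le_iff.1 (h ▸ (Ideal.span_singleton_le_iff_mem _).2 hx))
    have hbot := Ideal.iInf_pow_smul_eq_bot_of_isLocalRing (M := R ⧸ I) (Ideal.span {x}) hne
    refine haI ?_
    rw [← Submodule.Quotient.mk_eq_zero, ← Submodule.mem_bot R, ← hbot, Submodule.mem_iInf]
    intro i
    obtain ⟨b, hb⟩ := hall i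
    rw [Ideal.span_singleton_pow, Submodule.ideal_span_singleton_smul,
      Submodule.mem_smul_pointwise_iff_exists]
    refine ⟨I.mkQ b, trivial, ?_⟩
    rw [← map_smul, smul_eq_mul, mul_comm]
    exact ((Submodule.Quotient.eq I).2 hb).symm
  obtain ⟨i, b, hab, hb⟩ := key
  have h0 : (I ⊔ Ideal.span {x}).mkQ b ≠ 0 := by
    rwa [Submodule.mkQ_apply, Ne, Submodule.Quotient.mk_eq_zero]
  obtain ⟨Q, hQ, hle⟩ := exists_le_isAssociatedPrime_of_isNoetherianRing R _ h0
  refine ⟨Q, hQ, fun r hr => hle ?_⟩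
  rw [Submodule.mem_colon_singleton, ← map_smul, Submodule.mem_bot, Submodule.mkQ_apply,
    Submodule.Quotient.mk_eq_zero, smul_eq_mul]
  refine Ideal.mem_sup_left (hpow i _ ?_)
  have : r * b * x ^ i = r * a - r * (a - b * x ^ i) := by ring
  rw [this]
  exact I.sub_mem ((ha r).1 hr) (I.mul_mem_left _ hab)

theorem QuotientDepthGE.exists_regular {I : Ideal R} {t : ℕ} (h : QuotientDepthGE I (t + 1)) :
    ∃ x ∈ maximalIdeal R, ∀ c, c * x ∈ I → c ∈ I := by
  have h0 : Subsingleton ((R ⧸ maximalIdeal R) →ₗ[R] R ⧸ I) :=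
    have := h 0 (by omega)
    (CategoryTheory.Abelian.Ext.addEquiv₀.trans (ModuleCat.homAddEquiv
      (M := ModuleCat.of R (R ⧸ maximalIdeal R)) (N := ModuleCat.of R (R ⧸ I)))).symm.subsingleton
  obtain ⟨x, hx, hreg⟩ := IsSMulRegular.subsingleton_linearMap_iff.1 h0
  rw [Ideal.annihilator_quotient] at hx
  refine ⟨x, hx, fun c hc => ?_⟩
  rw [← Submodule.Quotient.mk_eq_zero]
  refine hreg ?_
  change x • I.mkQ c = x • 0
  rwa [smul_zero, ← map_smul, Submodule.mkQ_apply, Submodule.Quotient.mk_eq_zero, smul_eq_mul,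
    mul_comm]

/-- The depth of `R ⧸ I` is at most the dimension of `R ⧸ P` for every associated prime `P`. -/
theorem QuotientDepthGE.le_ringKrullDim {I P : Ideal R} {t : ℕ} (h : QuotientDepthGE I t)
    (hP : P ∈ associatedPrimes R (R ⧸ I)) : (t : WithBot ℕ∞) ≤ ringKrullDim (R ⧸ P) := by
  induction t generalizing I P with
  | zero =>
    have : P.IsPrime := hP.isPrime
    rw [Nat.cast_zero]
    exact ringKrullDim_nonneg_of_nontrivial
  | succ t ih =>
    have hprime : P.IsPrime := hP.isPrime
    obtain ⟨x, hx, hreg⟩ := h.exists_regular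
    obtain ⟨Q, hQ, hle⟩ := exists_mem_associatedPrimes_sup hP hx hreg
    have hxP : x ∉ P := by
      obtain ⟨-, a, ha⟩ := mem_associatedPrimes_quotient_iff.1 hP
      intro hxP
      have haI := hreg a (by rw [mul_comm]; exact (ha x).1 hxP)
      exact hprime.ne_top (P.eq_top_iff_one.2 ((ha 1).2 (by rwa [one_mul])))
    have hxQ : x ∈ Q := le_of_mem_associatedPrimes hQ
      (Ideal.mem_sup_right (Ideal.mem_span_singleton_self x))
    rw [Nat.cast_succ]
    -- The element x lies in Q but not in P, so the dimension drops by at least one.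
    refine le_trans (add_le_add_left (ih (h.sup_span_singleton hreg) hQ) 1) ?_
    refine ringKrullDim_succ_le_of_surjective (Ideal.Quotient.factor hle)
      (Ideal.Quotient.factor_surjective hle) (r := Ideal.Quotient.mk P x) ?_ ?_
    · rw [mem_nonZeroDivisors_iff_ne_zero, Ne, Ideal.Quotient.eq_zero_iff_mem]
      exact hxP
    · rw [Ideal.Quotient.factor_mk, Ideal.Quotient.eq_zero_iff_mem]
      exact hxQ

/-- Depth is at most dim R/P, which Krull's height theorem bounds by the number of elements cutting
out the closed point of R/P. -/
theorem QuotientDepthGE.le_card {I P : Ideal R} {t : ℕ} (h : QuotientDepthGE I t)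
    (hP : P ∈ associatedPrimes R (R ⧸ I)) (G : Finset R)
    (hG : maximalIdeal R ≤ (P ⊔ Ideal.span (G : Set R)).radical)
    (hG' : (G : Set R) ⊆ maximalIdeal R) : t ≤ G.card := by
  classical
  have hprime : P.IsPrime := hP.isPrime
  have h1 := h.le_ringKrullDim hP
  have : IsLocalRing (R ⧸ P) :=
    IsLocalRing.of_surjective' (Ideal.Quotient.mk P) Ideal.Quotient.mk_surjective
  rw [← maximalIdeal_height_eq_ringKrullDim] at h1
  have h2 : (maximalIdeal (R ⧸ P)).height ≤ (G.image (Ideal.Quotient.mk P)).card := by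
    apply Ideal.height_le_card_of_mem_minimalPrimes_span_finset
    have hcomap : (maximalIdeal (R ⧸ P)).comap (Ideal.Quotient.mk P) = maximalIdeal R :=
      IsLocalRing.eq_maximalIdeal
        (Ideal.comap_isMaximal_of_surjective _ Ideal.Quotient.mk_surjective)
    refine ⟨⟨inferInstance, ?_⟩, ?_⟩
    · rw [Finset.coe_image, Ideal.span_le]
      rintro _ ⟨g, hg, rfl⟩
      have := hG' hg
      rwa [SetLike.mem_coe, ← hcomap] at this
    · rintro q ⟨hq, hGq⟩ - y hy
      obtain ⟨y, rfl⟩ := Ideal.Quotient.mk_surjective y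
      have hy' : y ∈ maximalIdeal R := by rwa [← hcomap]
      have hle : (P ⊔ Ideal.span (G : Set R)).radical ≤ q.comap (Ideal.Quotient.mk P) := by
        have : (q.comap (Ideal.Quotient.mk P)).IsPrime := hq.comap _
        rw [this.radical_le_iff, sup_le_iff, Ideal.span_le]
        refine ⟨fun r hr => ?_, fun g hg => ?_⟩
        · rw [Ideal.mem_comap, Ideal.Quotient.eq_zero_iff_mem.2 hr]
          exact q.zero_mem
        · exact hGq (Ideal.subset_span (by simpa using ⟨g, hg, rfl⟩))
      exact hle (hG hy')
  have h3 : (maximalIdeal (R ⧸ P)).height ≤ (G.card : ℕ∞) :=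
    h2.trans (by exact_mod_cast Finset.card_image_le)
  have h4 : ((t : ℕ∞) : WithBot ℕ∞) ≤ ((maximalIdeal (R ⧸ P)).height : WithBot ℕ∞) := h1
  have h5 : (t : ℕ∞) ≤ (G.card : ℕ∞) := (WithBot.coe_le_coe.1 h4).trans h3
  exact_mod_cast h5

variable {ι : Type*} [Fintype ι] [DecidableEq ι]

omit [IsNoetherianRing R] [IsLocalRing R] [Fintype ι] in
theorem span_image_insert_eq_sup (g : ι → R) (j : ι) (S : Finset ι) :
    Ideal.span (g '' (insert j S : Finset ι)) = Ideal.span (g '' S) ⊔ Ideal.span {g j} := by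
  rw [← Ideal.span_union, Set.union_comm, ← Set.insert_eq, ← Set.image_insert_eq,
    ← Finset.coe_insert]

/-- In a local ring of depth `card ι`, elements `g i` generating an ideal primary to the maximal
ideal form a regular sequence in every order. -/
theorem regular_of_radical_span_eq (hdepth : QuotientDepthGE (⊥ : Ideal R) (Fintype.card ι))
    (g : ι → R) (hg : (Ideal.span (Set.range g)).radical = maximalIdeal R)
    (S : Finset ι) : QuotientDepthGE (Ideal.span (g '' S)) (Fintype.card ι - S.card) ∧
      ∀ j ∉ S, ∀ c, c * g j ∈ Ideal.span (g '' S) → c ∈ Ideal.span (g '' S) := by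
  have hgm (i : ι) : g i ∈ maximalIdeal R :=
    hg ▸ Ideal.le_radical (Ideal.subset_span ⟨i, rfl⟩)
  have main (S : Finset ι)
      (hS : QuotientDepthGE (Ideal.span (g '' S)) (Fintype.card ι - S.card)) :
      ∀ j ∉ S, ∀ c, c * g j ∈ Ideal.span (g '' S) → c ∈ Ideal.span (g '' S) := by
    classical
    intro j hj c hc
    by_contra hcI
    obtain ⟨P, hP, hjP⟩ := exists_mem_associatedPrimes_of_mul_mem hc hcI
    -- Modulo P the elements indexed by S and j vanish, so the remaining ones suffice; they are one
    -- fewer than the depth.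
    have hle := hS.le_card hP (((insert j S)ᶜ).image g) ?_ ?_
    · have h1 := hle.trans Finset.card_image_le
      rw [Finset.card_compl, Finset.card_insert_of_notMem hj] at h1
      have h2 : (insert j S).card ≤ Fintype.card ι := Finset.card_le_univ _
      rw [Finset.card_insert_of_notMem hj] at h2
      omega
    · rw [← hg]
      refine Ideal.radical_mono (Ideal.span_le.2 ?_)
      rintro _ ⟨i, rfl⟩
      by_cases hi : i ∈ insert j S
      · refine Ideal.mem_sup_left ?_
        rcases Finset.mem_insert.1 hi with rfl | hi
        · exact hjP
        · exact le_of_mem_associatedPrimes hP (Ideal.subset_span ⟨i, hi, rfl⟩)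
      · refine Ideal.mem_sup_right (Ideal.subset_span ?_)
        rw [Finset.coe_image]
        exact ⟨i, by rwa [Finset.mem_coe, Finset.mem_compl], rfl⟩
    · rw [Finset.coe_image]
      rintro _ ⟨i, -, rfl⟩
      exact hgm i
  have hd : QuotientDepthGE (Ideal.span (g '' S)) (Fintype.card ι - S.card) := by
    induction S using Finset.induction_on with
    | empty => simpa using hdepth
    | insert j S hj ih =>
      have h2 : (insert j S).card ≤ Fintype.card ι := Finset.card_le_univ _
      rw [Finset.card_insert_of_notMem hj] at h2 ⊢
      have e : Fintype.card ι - S.card = Fintype.card ι - (S.card + 1) + 1 := by omega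
      have h3 := ih
      rw [e] at h3
      have h4 := h3.sup_span_singleton (main S ih j hj)
      rwa [← span_image_insert_eq_sup] at h4
  exact ⟨hd, main S hd⟩

omit [IsNoetherianRing R] [Fintype ι] in
-- Used in both directions: upwards from the residue field to the power series ring, along the
-- variables, and downwards to the quotient by powers of parameters.
theorem depth_and_cyclic_of_regular (g : ι → R) (hgm : ∀ i, g i ∈ maximalIdeal R)
    (hreg : ∀ (S : Finset ι), ∀ j ∉ S, ∀ c, c * g j ∈ Ideal.span (g '' S) →
      c ∈ Ideal.span (g '' S)) (S : Finset ι) (t : ℕ) :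
    QuotientDepthGE (⊥ : Ideal R) (t + S.card) ∧ CyclicResidueExt (⊥ : Ideal R) (t + S.card) ↔
      QuotientDepthGE (Ideal.span (g '' S)) t ∧ CyclicResidueExt (Ideal.span (g '' S)) t := by
  induction S using Finset.induction_on generalizing t with
  | empty => simp
  | insert j S hj ih =>
    rw [Finset.card_insert_of_notMem hj, add_comm S.card, ← add_assoc, ih,
      span_image_insert_eq_sup]
    exact ⟨fun h => ⟨h.1.sup_span_singleton (hreg S j hj),
        h.2.sup_span_singleton h.1 (hgm j) (hreg S j hj)⟩,
      fun h => ⟨h.1.of_sup_span_singleton (hgm j) (hreg S j hj),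
        h.2.of_sup_span_singleton (hgm j) (hreg S j hj)⟩⟩

end Unmixedness

/-! ### Nondegenerate functionals and self-injectivity -/

section Frobenius

open IsLocalRing

/-- A finite-dimensional commutative algebra with a nondegenerate functional is self-injective. -/
theorem baer_of_nondegenerate {k A : Type*} [Field k] [CommRing A] [Algebra k A]
    [Module.Finite k A] (φ : A →ₗ[k] k) (hφ : ∀ a, (∀ b, φ (a * b) = 0) → a = 0) :
    Module.Baer A A := by
  intro I g
  have hinj : Function.Injective ((LinearMap.mul k A).compr₂ φ) := by
    rw [injective_iff_map_eq_zero]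
    intro a ha
    exact hφ a fun b => by simpa using LinearMap.congr_fun ha b
  have hsurj : Function.Surjective ((LinearMap.mul k A).compr₂ φ) :=
    (LinearMap.injective_iff_surjective_of_finrank_eq_finrank
      (Subspace.dual_finrank_eq (K := k) (V := A)).symm).1 hinj
  -- Extend φ ∘ g linearly to all of A; the extension has the form φ(r ·), and nondegeneracy forces
  -- g to be multiplication by r.
  obtain ⟨ψ, hψ⟩ := LinearMap.exists_extend (p := I.restrictScalars k)
    (φ ∘ₗ (g.restrictScalars k : I →ₗ[k] A))
  obtain ⟨r, hr⟩ := hsurj ψ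
  refine ⟨LinearMap.mul A A r, fun x hx => ?_⟩
  rw [eq_comm, ← sub_eq_zero]
  refine hφ _ fun y => ?_
  have h1 : ψ (x * y) = φ (g ⟨x * y, I.mul_mem_right y hx⟩) :=
    LinearMap.congr_fun hψ ⟨x * y, I.mul_mem_right y hx⟩
  have h2 : g ⟨x * y, I.mul_mem_right y hx⟩ = g ⟨x, hx⟩ * y := by
    have e : (⟨x * y, I.mul_mem_right y hx⟩ : I) = y • ⟨x, hx⟩ := Subtype.ext (mul_comm x y)
    rw [e, map_smul, smul_eq_mul, mul_comm]
  have h3 : ψ (x * y) = φ (r * (x * y)) := by rw [← hr]; simp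
  rw [sub_mul, map_sub, ← h2, ← h1, h3, sub_eq_zero]
  simp [mul_assoc]

theorem isGorensteinLocalRing_of_nondegenerate.{u, v} {k : Type v} {A : Type u} [Field k]
    [CommRing A] [Algebra k A] [Module.Finite k A] [IsNoetherianRing A] [IsLocalRing A]
    (φ : A →ₗ[k] k) (hφ : ∀ a, (∀ b, φ (a * b) = 0) → a = 0) : IsGorensteinLocalRing A := by
  refine ⟨inferInstance, inferInstance, ?_⟩
  have : Module.Injective A A := (baer_of_nondegenerate φ hφ).injective
  have : CategoryTheory.Injective (ModuleCat.of A A) :=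
    Module.injective_object_of_injective_module A A
  have h1 : CategoryTheory.injectiveDimension (ModuleCat.of A A) < ((1 : ℕ) : WithBot ℕ∞) := by
    rw [CategoryTheory.injectiveDimension_lt_iff]
    infer_instance
  exact h1.trans_le le_top

variable {k T : Type*} [Field k] [CommRing T] [Algebra k T] [IsNoetherianRing T] [IsLocalRing T]

theorem isGorensteinIdeal_of_functional {c : Ideal T} (hc : c ≠ ⊤) [Module.Finite k (T ⧸ c)]
    (Φ : T →ₗ[k] k) (h : ∀ x, x ∈ c ↔ ∀ y, Φ (x * y) = 0) : IsGorensteinIdeal c := by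
  have : Nontrivial (T ⧸ c) := Ideal.Quotient.nontrivial_iff.2 hc
  have : IsLocalRing (T ⧸ c) :=
    IsLocalRing.of_surjective' (Ideal.Quotient.mk c) Ideal.Quotient.mk_surjective
  have hle : c.restrictScalars k ≤ LinearMap.ker Φ := fun x hx => by
    simpa using (h x).1 hx 1
  refine isGorensteinLocalRing_of_nondegenerate ((c.restrictScalars k).liftQ Φ hle) fun a ha => ?_
  obtain ⟨a, rfl⟩ := Ideal.Quotient.mk_surjective a
  rw [Ideal.Quotient.eq_zero_iff_mem, h]
  exact fun y => ha (Ideal.Quotient.mk c y)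

omit [IsNoetherianRing T] [IsLocalRing T] in
/-- The colon ideal of a Gorenstein ideal by an element inherits the defining functional. -/
theorem mem_colon_singleton_iff_functional {q : Ideal T} {Φ : T →ₗ[k] k}
    (h : ∀ x, x ∈ q ↔ ∀ y, Φ (x * y) = 0) (z x : T) :
    x ∈ q.colon {z} ↔ ∀ y, (Φ ∘ₗ LinearMap.mulLeft k z) (x * y) = 0 := by
  rw [Submodule.mem_colon_singleton, smul_eq_mul, h]
  refine forall_congr' fun y => ?_
  rw [LinearMap.comp_apply, LinearMap.mulLeft_apply, ← mul_assoc, mul_comm z]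

theorem exists_fg_sup_pow_maximalIdeal_eq_top
    (hk : ∀ x : T, ∃ c : k, x - algebraMap k T c ∈ maximalIdeal T) (N : ℕ) :
    ∃ V : Submodule k T, V.FG ∧ V ⊔ (maximalIdeal T ^ N).restrictScalars k = ⊤ := by
  classical
  induction N with
  | zero => exact ⟨⊥, Submodule.fg_bot, by simp⟩
  | succ N ih =>
    obtain ⟨V, hV, hVT⟩ := ih
    obtain ⟨G, hG⟩ := IsNoetherian.noetherian (maximalIdeal T ^ N)
    refine ⟨V ⊔ Submodule.span k G, hV.sup (Submodule.fg_span G.finite_toSet), ?_⟩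
    rw [eq_top_iff, ← hVT, sup_assoc]
    refine sup_le_sup_left ?_ V
    intro x hx
    rw [Submodule.restrictScalars_mem, ← hG] at hx
    induction hx using Submodule.span_induction with
    | mem x hx => exact Submodule.mem_sup_left (Submodule.subset_span hx)
    | zero => exact Submodule.zero_mem _
    | add x y _ _ hx hy => exact Submodule.add_mem _ hx hy
    | smul a x hxG hx =>
      obtain ⟨c, hc⟩ := hk a
      have e : a • x = c • x + (a - algebraMap k T c) * x := by
        rw [Algebra.smul_def c, smul_eq_mul]
        ring
      rw [e]
      refine Submodule.add_mem _ (Submodule.smul_mem _ c hx) (Submodule.mem_sup_right ?_)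
      rw [Submodule.restrictScalars_mem, pow_succ']
      exact Ideal.mul_mem_mul hc (hG ▸ hxG)

theorem finite_quotient_of_pow_maximalIdeal_le
    (hk : ∀ x : T, ∃ c : k, x - algebraMap k T c ∈ maximalIdeal T) {q : Ideal T} {N : ℕ}
    (hq : maximalIdeal T ^ N ≤ q) : Module.Finite k (T ⧸ q) := by
  obtain ⟨V, hV, hVT⟩ := exists_fg_sup_pow_maximalIdeal_eq_top hk N
  refine ⟨?_⟩
  have : V.map (Ideal.Quotient.mkₐ k q).toLinearMap = ⊤ := by
    rw [eq_top_iff]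
    rintro x -
    obtain ⟨x, rfl⟩ := Ideal.Quotient.mk_surjective x
    have hx : x ∈ V ⊔ (maximalIdeal T ^ N).restrictScalars k := hVT ▸ trivial
    obtain ⟨v, hv, w, hw, rfl⟩ := Submodule.mem_sup.1 hx
    refine ⟨v, hv, ?_⟩
    rw [map_add, Ideal.Quotient.eq_zero_iff_mem.2 (hq hw), add_zero]
    rfl
  rw [← this]
  exact hV.map _

omit [IsNoetherianRing T] in
-- The multiplier y is taken from the last power of the maximal ideal that does not carry x into q.
theorem exists_socle_multiple {q : Ideal T} {N : ℕ} {x : T}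
    (hN : ∀ y ∈ maximalIdeal T ^ N, x * y ∈ q) (hx : x ∉ q) :
    ∃ y, x * y ∉ q ∧ ∀ z ∈ maximalIdeal T, z * (x * y) ∈ q := by
  induction N with
  | zero => exact absurd (by simpa using hN 1 (by simp)) hx
  | succ N ih =>
    by_cases h : ∀ y ∈ maximalIdeal T ^ N, x * y ∈ q
    · exact ih h
    · push Not at h
      obtain ⟨y, hy, hxy⟩ := h
      refine ⟨y, hxy, fun z hz => ?_⟩
      rw [mul_left_comm]
      refine hN _ ?_
      rw [pow_succ']
      exact Ideal.mul_mem_mul hz hy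

omit [IsNoetherianRing T] in
-- Any functional on T/q that is nonzero on the socle generator works, since each nonzero ideal of
-- T/q meets the socle. If σ ∈ q, the socle is zero, hence q = T and Φ = 0 serves.
theorem exists_functional_of_socle
    (hk : ∀ x : T, ∃ c : k, x - algebraMap k T c ∈ maximalIdeal T) {q : Ideal T} {N : ℕ}
    (hq : maximalIdeal T ^ N ≤ q) {σ : T} (hσ : ∀ x ∈ maximalIdeal T, x * σ ∈ q)
    (hgen : ∀ z : T, (∀ x ∈ maximalIdeal T, x * z ∈ q) → ∃ r, z - r * σ ∈ q) :
    ∃ Φ : T →ₗ[k] k, ∀ x, x ∈ q ↔ ∀ y, Φ (x * y) = 0 := by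
  by_cases hσq : σ ∈ q
  · refine ⟨0, fun x => ⟨fun _ _ => rfl, fun _ => ?_⟩⟩
    by_contra hx
    obtain ⟨y, hxy, hs⟩ := exists_socle_multiple (fun y hy => q.mul_mem_left x (hq hy)) hx
    obtain ⟨r, hr⟩ := hgen _ hs
    exact hxy ((Submodule.sub_mem_iff_left q (q.mul_mem_left r hσq)).1 hr)
  · have hne : Ideal.Quotient.mk q σ ≠ 0 := by rwa [Ne, Ideal.Quotient.eq_zero_iff_mem]
    obtain ⟨φ, hφ⟩ : ∃ φ : Module.Dual k (T ⧸ q), φ (Ideal.Quotient.mk q σ) ≠ 0 := by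
      by_contra! H
      exact hne ((Module.forall_dual_apply_eq_zero_iff k _).1 H)
    refine ⟨φ ∘ₗ (Ideal.Quotient.mkₐ k q).toLinearMap, fun x => ⟨fun hx y => ?_, fun H => ?_⟩⟩
    · change φ (Ideal.Quotient.mk q (x * y)) = 0
      rw [Ideal.Quotient.eq_zero_iff_mem.2 (q.mul_mem_right y hx), map_zero]
    · by_contra hx
      obtain ⟨y, hxy, hs⟩ := exists_socle_multiple (fun y hy => q.mul_mem_left x (hq hy)) hx
      obtain ⟨r, hr⟩ := hgen _ hs
      obtain ⟨c, hc⟩ := hk r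
      have h1 : x * y - algebraMap k T c * σ ∈ q := by
        have : x * y - algebraMap k T c * σ = (x * y - r * σ) + (r - algebraMap k T c) * σ := by
          ring
        rw [this]
        exact q.add_mem hr (hσ _ hc)
      have h2 : Ideal.Quotient.mk q (x * y) = c • Ideal.Quotient.mk q σ := by
        rw [Ideal.Quotient.mk_eq_mk_iff_sub_mem _ _ |>.2 h1, Algebra.smul_def, map_mul]
        rfl
      have h3 : φ (Ideal.Quotient.mk q (x * y)) = 0 := H y
      rw [h2, map_smul, smul_eq_mul] at h3
      rcases mul_eq_zero.1 h3 with rfl | h3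
      · rw [map_zero, zero_mul, sub_zero] at h1
        exact hxy h1
      · exact hφ h3

end Frobenius

/-! ### Regular sequences and functionals for power series rings -/

section PowerSeries

open IsLocalRing

namespace MvPowerSeries

variable {σ R : Type*} [CommRing R] [DecidableEq σ]

theorem mem_span_X_image_iff (S : Finset σ) (f : MvPowerSeries σ R) :
    f ∈ Ideal.span ((X : σ → MvPowerSeries σ R) '' S) ↔
      ∀ m : σ →₀ ℕ, (∀ j ∈ S, m j = 0) → coeff m f = 0 := by
  constructor
  · intro h
    induction h using Submodule.span_induction with
    | mem f hf =>
      obtain ⟨j, hj, rfl⟩ := hf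
      exact fun m hm => X_dvd_iff.1 dvd_rfl m (hm j hj)
    | zero => simp
    | add f g _ _ hf hg =>
      intro m hm
      rw [map_add, hf m hm, hg m hm, add_zero]
    | smul a f _ hf =>
      intro m hm
      rw [smul_eq_mul, coeff_mul]
      refine Finset.sum_eq_zero fun p hp => ?_
      rw [hf p.2, mul_zero]
      intro j hj
      have h1 := hm j hj
      rw [← Finset.HasAntidiagonal.mem_antidiagonal.1 hp, Finsupp.add_apply] at h1
      omega
  · induction S using Finset.induction_on generalizing f with
    | empty =>
      intro h
      have : f = 0 := by
        ext m
        exact h m (by simp)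
      rw [this]
      exact Ideal.zero_mem _
    | insert j S hj ih =>
      intro h
      -- The part of f free of `X j`; the rest is divisible by `X j`.
      let f₀ : MvPowerSeries σ R := fun m => if m j = 0 then coeff m f else 0
      have hf₀ (m : σ →₀ ℕ) : coeff m f₀ = if m j = 0 then coeff m f else 0 := rfl
      obtain ⟨g, hg⟩ : X j ∣ f - f₀ := by
        rw [X_dvd_iff]
        intro m hm
        rw [map_sub, hf₀, if_pos hm, sub_self]
      rw [span_image_insert_eq_sup, ← sub_add_cancel f f₀, hg]
      refine Ideal.add_mem _ (Ideal.mem_sup_right (Ideal.mem_span_singleton.2 ⟨g, rfl⟩))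
        (Ideal.mem_sup_left (ih _ fun m hm => ?_))
      rw [hf₀]
      split_ifs with h0
      · exact h m (by simpa [h0] using hm)
      · rfl

theorem mem_span_X_image_of_mul_X_mem (S : Finset σ) (j : σ) (hj : j ∉ S)
    (c : MvPowerSeries σ R) (h : c * X j ∈ Ideal.span ((X : σ → MvPowerSeries σ R) '' S)) :
    c ∈ Ideal.span ((X : σ → MvPowerSeries σ R) '' S) := by
  rw [mem_span_X_image_iff] at h ⊢
  intro m hm
  have := h (m + Finsupp.single j 1) fun i hi => by
    have hij : j ≠ i := by rintro rfl; exact hj hi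
    simp [hm i hi, hij]
  rwa [X, coeff_add_mul_monomial, mul_one] at this

variable {k : Type*} [Field k]

omit [DecidableEq σ] in
theorem mem_maximalIdeal_iff_constantCoeff {f : MvPowerSeries σ k} :
    f ∈ maximalIdeal (MvPowerSeries σ k) ↔ constantCoeff f = 0 := by
  rw [mem_maximalIdeal, mem_nonunits_iff, isUnit_iff_constantCoeff, isUnit_iff_ne_zero, not_not]

theorem span_X_eq_maximalIdeal [Fintype σ] :
    Ideal.span ((X : σ → MvPowerSeries σ k) '' (Finset.univ : Finset σ)) =
      maximalIdeal (MvPowerSeries σ k) := by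
  ext f
  rw [mem_span_X_image_iff, mem_maximalIdeal_iff_constantCoeff, ← coeff_zero_eq_constantCoeff_apply]
  constructor
  · exact fun h => h 0 (by simp)
  · intro h m hm
    have : m = 0 := by
      ext j
      simpa using hm j (Finset.mem_univ j)
    rwa [this]

theorem depth_and_cyclic [Fintype σ] :
    QuotientDepthGE (⊥ : Ideal (MvPowerSeries σ k)) (Fintype.card σ) ∧
      CyclicResidueExt (⊥ : Ideal (MvPowerSeries σ k)) (Fintype.card σ) := by
  have h := depth_and_cyclic_of_regular (X : σ → MvPowerSeries σ k)
    (fun i => by rw [mem_maximalIdeal_iff_constantCoeff, constantCoeff_X])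
    (fun S j hj c hc => mem_span_X_image_of_mul_X_mem S j hj c hc) Finset.univ 0
  rw [zero_add, Finset.card_univ, span_X_eq_maximalIdeal] at h
  exact h.2 ⟨fun i hi => absurd hi (Nat.not_lt_zero i), cyclicResidueExt_maximalIdeal⟩

omit [DecidableEq σ] in
theorem exists_sub_algebraMap_mem_maximalIdeal (x : MvPowerSeries σ k) :
    ∃ c : k, x - algebraMap k _ c ∈ maximalIdeal (MvPowerSeries σ k) := by
  refine ⟨constantCoeff x, ?_⟩
  rw [mem_maximalIdeal_iff_constantCoeff, map_sub, sub_eq_zero]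
  simp [algebraMap_apply]

variable [Fintype σ]

/-- Elements generating an ideal primary to the maximal ideal form a regular sequence. -/
theorem mem_span_image_of_mul_mem (g : σ → MvPowerSeries σ k)
    (hg : (Ideal.span (Set.range g)).radical = maximalIdeal (MvPowerSeries σ k))
    (S : Finset σ) (j : σ) (hj : j ∉ S) (c : MvPowerSeries σ k)
    (h : c * g j ∈ Ideal.span (g '' S)) : c ∈ Ideal.span (g '' S) :=
  (regular_of_radical_span_eq depth_and_cyclic.1 g hg S).2 j hj c h

omit [DecidableEq σ] in
theorem exists_pow_maximalIdeal_le {q : Ideal (MvPowerSeries σ k)}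
    (hq : q.radical = maximalIdeal (MvPowerSeries σ k)) :
    ∃ N, maximalIdeal (MvPowerSeries σ k) ^ N ≤ q :=
  hq ▸ q.exists_radical_pow_le_of_fg (IsNoetherian.noetherian _)

theorem exists_functional (g : σ → MvPowerSeries σ k)
    (hg : (Ideal.span (Set.range g)).radical = maximalIdeal (MvPowerSeries σ k)) :
    ∃ Φ : MvPowerSeries σ k →ₗ[k] k, ∀ x, x ∈ Ideal.span (Set.range g) ↔ ∀ y, Φ (x * y) = 0 := by
  have hgm (i : σ) : g i ∈ maximalIdeal (MvPowerSeries σ k) :=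
    hg ▸ Ideal.le_radical (Ideal.subset_span ⟨i, rfl⟩)
  have h := depth_and_cyclic_of_regular g hgm (mem_span_image_of_mul_mem g hg) Finset.univ 0
  rw [zero_add, Finset.card_univ, Finset.coe_univ, Set.image_univ] at h
  obtain ⟨s, hs, hgen⟩ := (h.1 depth_and_cyclic).2.exists_socle_generator
  obtain ⟨N, hN⟩ := exists_pow_maximalIdeal_le hg
  exact exists_functional_of_socle exists_sub_algebraMap_mem_maximalIdeal hN hs hgen

end MvPowerSeries

end PowerSeries

/-! ### Colon ideals of powers of the parameters -/

section LefschetzColon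

open MvPolynomial

variable {ι T : Type*} [CommRing T] [Fintype ι]

/-- Cancellation of `∏ fᵢ ^ m` modulo `(fᵢ ^ (m + 1))` when the powers of the `fᵢ` form regular
sequences. -/
theorem mem_span_of_mul_prod_pow_mem [DecidableEq ι] (f : ι → T) (m : ℕ)
    (hreg : ∀ a : ι → ℕ, (∀ i, a i ≠ 0) → ∀ (S : Finset ι), ∀ j ∉ S, ∀ c,
      c * f j ^ a j ∈ Ideal.span ((fun i => f i ^ a i) '' S) →
      c ∈ Ideal.span ((fun i => f i ^ a i) '' S)) (c : T)
    (h : c * ∏ i, f i ^ m ∈ Ideal.span (Set.range fun i => f i ^ (m + 1))) :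
    c ∈ Ideal.span (Set.range f) := by
  -- `hreg` needs nonzero exponents and is applied below with exponent m at one index.
  rcases Nat.eq_zero_or_pos m with rfl | hm
  · simpa using h
  -- The exponents m + 1 are lowered to 1 one index at a time, cancelling the factor `f j ^ m` at
  -- each stage.
  have main (S : Finset ι) (c : T) (h : c * ∏ i ∈ S, f i ^ m ∈
      Ideal.span ((fun i => f i ^ (if i ∈ S then m + 1 else 1)) '' (Finset.univ : Finset ι))) :
      c ∈ Ideal.span (Set.range f) := by
    induction S using Finset.induction_on generalizing c with
    | empty => simpa using h
    | insert j S hj ih =>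
      refine ih c ?_
      rw [← Finset.insert_erase (Finset.mem_univ j), span_image_insert_eq_sup] at h ⊢
      have himg : (fun i => f i ^ (if i ∈ insert j S then m + 1 else 1)) ''
          ((Finset.univ.erase j : Finset ι) : Set ι) =
          (fun i => f i ^ (if i ∈ S then m + 1 else 1)) ''
          ((Finset.univ.erase j : Finset ι) : Set ι) := by
        refine Set.image_congr fun i hi => ?_
        have hij : i ≠ j := Finset.ne_of_mem_erase hi
        simp [hij]
      rw [himg] at h
      simp only [Finset.mem_insert_self, if_true] at h
      rw [if_neg hj, pow_one]
      obtain ⟨u, hu, v, hv, huv⟩ := Submodule.mem_sup.1 h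
      obtain ⟨t, rfl⟩ := Ideal.mem_span_singleton'.1 hv
      have himg' : (fun i => f i ^ (if i ∈ S then m + 1 else 1)) ''
          ((Finset.univ.erase j : Finset ι) : Set ι) =
          (fun i => f i ^ (if i = j then m else if i ∈ S then m + 1 else 1)) ''
          ((Finset.univ.erase j : Finset ι) : Set ι) := by
        refine Set.image_congr fun i hi => ?_
        have hij : i ≠ j := Finset.ne_of_mem_erase hi
        simp [hij]
      have hmem := hreg (fun i => if i = j then m else if i ∈ S then m + 1 else 1)
        (fun i => by split_ifs <;> omega) (Finset.univ.erase j) j (by simp)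
        (c * ∏ i ∈ S, f i ^ m - t * f j) (by
          rw [← himg', if_pos rfl]
          have : (c * ∏ i ∈ S, f i ^ m - t * f j) * f j ^ m = u := by
            rw [Finset.prod_insert hj] at huv
            linear_combination -huv
          rwa [this])
      rw [← himg'] at hmem
      rw [← sub_add_cancel (c * ∏ i ∈ S, f i ^ m) (t * f j)]
      exact Ideal.add_mem _ (Ideal.mem_sup_left hmem)
        (Ideal.mem_sup_right (Ideal.mul_mem_left _ _ (Ideal.mem_span_singleton_self _)))
  exact main Finset.univ c (by simpa using h)

theorem prod_pow_mem_span_pow (f : ι → T) (a : ι →₀ ℕ) :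
    ∏ i, f i ^ a i ∈ Ideal.span (Set.range f) ^ a.degree := by
  rw [Ideal.mem_span_pow_iff_exists_isHomogeneous]
  refine ⟨monomial a 1, isHomogeneous_monomial _ rfl, ?_⟩
  rw [eval_monomial, one_mul, Finsupp.prod_fintype _ _ (by simp)]

theorem prod_pow_mem_span_range_pow (f : ι → T) {m : ℕ} {a : ι →₀ ℕ} (h : ∃ j, m < a j) :
    ∏ i, f i ^ a i ∈ Ideal.span (Set.range fun i => f i ^ (m + 1)) := by
  obtain ⟨j, hj⟩ := h
  refine Ideal.mem_of_dvd _ ?_ (Ideal.subset_span ⟨j, rfl⟩)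
  exact (pow_dvd_pow _ hj).trans (Finset.dvd_prod_of_mem _ (Finset.mem_univ j))

theorem eval_eq_sum_coeff (f : ι → T) (p : MvPolynomial ι T) :
    eval f p = ∑ a ∈ p.support, coeff a p * ∏ i, f i ^ a i :=
  eval_eq' f p

/-- Pigeonhole: a monomial of degree above dm, with d the number of generators, has an exponent
above m. -/
theorem span_pow_le_span_range_pow (f : ι → T) {m e : ℕ} (he : Fintype.card ι * m < e) :
    Ideal.span (Set.range f) ^ e ≤ Ideal.span (Set.range fun i => f i ^ (m + 1)) := by
  intro y hy
  obtain ⟨p, hp, rfl⟩ := (Ideal.mem_span_pow_iff_exists_isHomogeneous f y).1 hy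
  rw [eval_eq_sum_coeff]
  refine Ideal.sum_mem _ fun a ha => Ideal.mul_mem_left _ _ (prod_pow_mem_span_range_pow f ?_)
  by_contra! hle
  have hdeg : a.degree = e := by
    by_contra hne
    exact mem_support_iff.1 ha (hp.coeff_eq_zero hne)
  have : a.degree ≤ Fintype.card ι * m := by
    rw [Finsupp.degree_eq_sum]
    exact (Finset.sum_le_sum fun i _ => hle i).trans (by simp)
  omega

/-- The coefficient of the socle monomial of an element of `(fᵢ ^ (m + 1))` lies in `(fᵢ)`. -/
theorem coeff_mem_span_of_eval_mem (f : ι → T) (m : ℕ)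
    (hcolon : ∀ c, c * ∏ i, f i ^ m ∈ Ideal.span (Set.range fun i => f i ^ (m + 1)) →
      c ∈ Ideal.span (Set.range f)) {p : MvPolynomial ι T}
    (hp : p.IsHomogeneous (Fintype.card ι * m))
    (h : eval f p ∈ Ideal.span (Set.range fun i => f i ^ (m + 1))) :
    coeff (Finsupp.equivFunOnFinite.symm fun _ => m) p ∈ Ideal.span (Set.range f) := by
  classical
  set u : ι →₀ ℕ := Finsupp.equivFunOnFinite.symm fun _ => m with hu
  have hui (i : ι) : u i = m := rfl
  by_cases hus : u ∈ p.support
  · refine hcolon _ ?_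
    rw [eval_eq_sum_coeff, ← Finset.add_sum_erase _ _ hus] at h
    refine (Submodule.add_mem_iff_left _ (Ideal.sum_mem _ fun a ha => ?_)).1 h
    refine Ideal.mul_mem_left _ _ (prod_pow_mem_span_range_pow f ?_)
    by_contra! hle
    have hdeg : a.degree = Fintype.card ι * m := by
      by_contra hne
      exact mem_support_iff.1 (Finset.mem_of_mem_erase ha) (hp.coeff_eq_zero hne)
    refine Finset.ne_of_mem_erase ha ?_
    have hsum : ∑ i, a i = ∑ _i : ι, m := by
      rw [← Finsupp.degree_eq_sum, hdeg]
      simp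
    ext i
    rw [hui]
    exact (Finset.sum_eq_sum_iff_of_le fun i _ => hle i).1 hsum i (Finset.mem_univ i)
  · rw [notMem_support_iff.1 hus]
    exact Ideal.zero_mem _

/-- The inductive step for colon ideals: the Lefschetz property over T/D forces the coefficients of
a form representing g into D. -/
theorem mem_span_pow_succ_of_forall_mul_mem (f : ι → T) (m : ℕ)
    [IsAddTorsionFree (T ⧸ Ideal.span (Set.range f))]
    (hcolon : ∀ c, c * ∏ i, f i ^ m ∈ Ideal.span (Set.range fun i => f i ^ (m + 1)) →
      c ∈ Ideal.span (Set.range f)) {i s : ℕ} (him : i ≤ m)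
    (his : 2 * i + s ≤ Fintype.card ι * m) {g : T} (hg : g ∈ Ideal.span (Set.range f) ^ i)
    (h : ∀ b : ι →₀ ℕ, b.degree + s + i = Fintype.card ι * m →
      (∏ j, f j ^ b j) * ((∑ j, f j) ^ s * g) ∈
        Ideal.span (Set.range fun i => f i ^ (m + 1))) :
    g ∈ Ideal.span (Set.range f) ^ (i + 1) := by
  classical
  set D := Ideal.span (Set.range f) with hD
  obtain ⟨p, hp, rfl⟩ := (Ideal.mem_span_pow_iff_exists_isHomogeneous f g).1 hg
  have hL : (∑ j, X j : MvPolynomial ι T).IsHomogeneous 1 :=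
    IsHomogeneous.sum _ _ _ fun j _ => isHomogeneous_X T j
  have hP : ((∑ j, X j) ^ s * p).IsHomogeneous (s + i) := by simpa using (hL.pow s).mul hp
  have hcoeff (a : ι →₀ ℕ) (ha : ∀ j, a j ≤ m) : coeff a ((∑ j, X j) ^ s * p) ∈ D := by
    by_cases hdeg : a.degree = s + i
    · set u : ι →₀ ℕ := Finsupp.equivFunOnFinite.symm fun _ => m with hu
      have hua : a ≤ u := fun j => ha j
      have hudeg : u.degree = Fintype.card ι * m := by
        rw [Finsupp.degree_eq_sum]
        simp [hu]
      have hb : (u - a).degree + (s + i) = Fintype.card ι * m := by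
        rw [← hdeg, ← map_add, tsub_add_cancel_of_le hua, hudeg]
      -- Multiplication by X^(u-a) moves the coefficient at a to the socle monomial X^u.
      have h1 := h (u - a) (by rw [add_assoc, hb])
      have h2 := coeff_mem_span_of_eval_mem f m hcolon
        (p := monomial (u - a) 1 * ((∑ j, X j) ^ s * p))
        (hb ▸ (isHomogeneous_monomial _ rfl).mul hP) (by
          rw [map_mul, eval_monomial, one_mul, Finsupp.prod_fintype _ _ (by simp)]
          simpa using h1)
      rw [← hu, coeff_monomial_mul', if_pos tsub_le_self, one_mul,
        tsub_tsub_cancel_of_le hua] at h2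
      exact h2
    · rw [hP.coeff_eq_zero hdeg]
      exact D.zero_mem
  have hmem : map (Ideal.Quotient.mk D) p ∈
      Ideal.span (Set.range fun j : ι => (X j : MvPolynomial ι (T ⧸ D)) ^ (m + 1)) := by
    refine mem_span_X_pow_of_sum_X_pow_mul_mem m i s (hp.map _) his ?_
    have e : (∑ j, X j) ^ s * map (Ideal.Quotient.mk D) p =
        map (Ideal.Quotient.mk D) ((∑ j, X j) ^ s * p) := by simp
    rw [e, mem_span_X_pow_iff]
    intro a ha
    rw [coeff_map, Ideal.Quotient.eq_zero_iff_mem]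
    exact hcoeff a ha
  rw [mem_span_X_pow_iff] at hmem
  rw [eval_eq_sum_coeff, pow_succ']
  refine Ideal.sum_mem _ fun a ha => ?_
  have hdeg : a.degree = i := by
    by_contra hne
    exact mem_support_iff.1 ha (hp.coeff_eq_zero hne)
  refine Ideal.mul_mem_mul ?_ (hdeg ▸ prod_pow_mem_span_pow f a)
  -- No exponent in a form of degree i ≤ m exceeds m, so membership in the monomial ideal kills
  -- every coefficient.
  have h3 := hmem a fun j => (Finsupp.le_degree j a).trans (by omega)
  rwa [coeff_map, Ideal.Quotient.eq_zero_iff_mem] at h3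

theorem mem_span_pow_of_mul_mem_colon (f : ι → T) (m : ℕ)
    [IsAddTorsionFree (T ⧸ Ideal.span (Set.range f))]
    (hcolon : ∀ c, c * ∏ i, f i ^ m ∈ Ideal.span (Set.range fun i => f i ^ (m + 1)) →
      c ∈ Ideal.span (Set.range f)) {j s e : ℕ} (hj : j ≤ m + 1)
    (hsum : j + s + e = Fintype.card ι * m + 1) (hse : Fintype.card ι * m ≤ s + 2 * e) {g : T}
    (h : ∀ y ∈ Ideal.span (Set.range f) ^ e,
      (∑ j, f j) ^ s * (g * y) ∈ Ideal.span (Set.range fun i => f i ^ (m + 1))) :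
    g ∈ Ideal.span (Set.range f) ^ j := by
  have main (i : ℕ) (hi : i ≤ j) : g ∈ Ideal.span (Set.range f) ^ i := by
    induction i with
    | zero => simp
    | succ i ih =>
      refine mem_span_pow_succ_of_forall_mul_mem f m hcolon (s := s) (by omega) (by omega)
        (ih (by omega)) fun b hb => ?_
      have h1 := h _ (Ideal.pow_le_pow_right (by omega : e ≤ b.degree) (prod_pow_mem_span_pow f b))
      convert h1 using 1
      ring
  exact main j le_rfl

/-- Powers of the sum below the socle degree do not lie in `(fᵢ ^ (m + 1))`. -/
theorem sum_pow_notMem_span_range_pow (f : ι → T) (m : ℕ)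
    [IsAddTorsionFree (T ⧸ Ideal.span (Set.range f))]
    (hcolon : ∀ c, c * ∏ i, f i ^ m ∈ Ideal.span (Set.range fun i => f i ^ (m + 1)) →
      c ∈ Ideal.span (Set.range f)) (hf : Ideal.span (Set.range f) ≠ ⊤) {s : ℕ}
    (hs : s ≤ Fintype.card ι * m) :
    (∑ j, f j) ^ s ∉ Ideal.span (Set.range fun i => f i ^ (m + 1)) := by
  intro h
  -- The inductive step with i = 0 and g = 1 would make D the unit ideal.
  have h1 : (1 : T) ∈ Ideal.span (Set.range f) ^ (0 + 1) := by
    refine mem_span_pow_succ_of_forall_mul_mem f m hcolon (s := s) (Nat.zero_le m) (by omega)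
      (by simp) fun b _ => ?_
    rw [mul_one]
    exact Ideal.mul_mem_left _ _ h
  rw [zero_add, pow_one] at h1
  exact hf ((Ideal.eq_top_iff_one _).2 h1)

end LefschetzColon

/-! ### Gorenstein links between powers of D -/

section GorensteinLinkage

open IsLocalRing

theorem isAddTorsionFree_of_charZero_algebra (k : Type*) {A : Type*} [Field k] [CharZero k]
    [CommRing A] [Algebra k A] : IsAddTorsionFree A where
  nsmul_right_injective n hn x y hxy := by
    have h : (n : k) • x = (n : k) • y := by simpa [Nat.cast_smul_eq_nsmul] using hxy
    exact smul_right_injective A (Nat.cast_ne_zero.2 hn : (n : k) ≠ 0) h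

theorem radical_span_range_pow {T ι : Type*} [CommRing T] (f : ι → T) (a : ι → ℕ)
    (ha : ∀ i, a i ≠ 0) :
    (Ideal.span (Set.range fun i => f i ^ a i)).radical = (Ideal.span (Set.range f)).radical := by
  refine le_antisymm (Ideal.radical_mono (Ideal.span_le.2 ?_))
    (Ideal.radical_le_radical_iff.2 (Ideal.span_le.2 ?_))
  · rintro _ ⟨i, rfl⟩
    exact Ideal.pow_mem_of_mem _ (Ideal.subset_span (Set.mem_range_self i)) _ (Nat.pos_of_ne_zero (ha i))
  · rintro _ ⟨i, rfl⟩
    exact ⟨a i, Ideal.subset_span ⟨i, rfl⟩⟩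

variable {k : Type*} [Field k] {d : ℕ} {f : Fin d → MvPowerSeries (Fin d) k}

namespace IsSystemOfParameters

theorem mem_span_of_mul_prod_pow_mem (hf : IsSystemOfParameters f) (m : ℕ)
    (c : MvPowerSeries (Fin d) k)
    (h : c * ∏ i, f i ^ m ∈ Ideal.span (Set.range fun i => f i ^ (m + 1))) :
    c ∈ Ideal.span (Set.range f) :=
  _root_.mem_span_of_mul_prod_pow_mem f m (fun a ha S j hj c hc =>
    MvPowerSeries.mem_span_image_of_mul_mem (fun i => f i ^ a i)
      ((radical_span_range_pow f a ha).trans hf.2) S j hj c hc) c h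

theorem span_ne_top (hf : IsSystemOfParameters f) : Ideal.span (Set.range f) ≠ ⊤ := by
  intro h
  have h2 := hf.2
  rw [h, Ideal.radical_top] at h2
  exact (Ideal.IsPrime.ne_top inferInstance : maximalIdeal (MvPowerSeries (Fin d) k) ≠ ⊤) h2.symm

variable [CharZero k]

theorem isGorensteinIdeal_powerColon (hf : IsSystemOfParameters f) {m s : ℕ} (hs : s ≤ d * m) :
    IsGorensteinIdeal (powerColon f (m + 1) s) := by
  have := isAddTorsionFree_of_charZero_algebra k
    (A := MvPowerSeries (Fin d) k ⧸ Ideal.span (Set.range f))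
  have hrad := (radical_span_range_pow f (fun _ => m + 1) (fun _ => m.succ_ne_zero)).trans hf.2
  obtain ⟨Φ, hΦ⟩ := MvPowerSeries.exists_functional (fun i => f i ^ (m + 1)) hrad
  obtain ⟨N, hN⟩ := MvPowerSeries.exists_pow_maximalIdeal_le hrad
  have hle : Ideal.span (Set.range fun i => f i ^ (m + 1)) ≤ powerColon f (m + 1) s :=
    fun x hx => Submodule.mem_colon_singleton.2 (Ideal.mul_mem_right _ _ hx)
  have hne : powerColon f (m + 1) s ≠ ⊤ := by
    rw [Ne, Ideal.eq_top_iff_one, powerColon, Submodule.mem_colon_singleton, one_smul]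
    exact sum_pow_notMem_span_range_pow f m (hf.mem_span_of_mul_prod_pow_mem m) hf.span_ne_top
      (by simpa using hs)
  have : Module.Finite k (MvPowerSeries (Fin d) k ⧸ powerColon f (m + 1) s) :=
    finite_quotient_of_pow_maximalIdeal_le MvPowerSeries.exists_sub_algebraMap_mem_maximalIdeal
      (hN.trans hle)
  exact isGorensteinIdeal_of_functional hne _
    fun x => mem_colon_singleton_iff_functional hΦ ((∑ i, f i) ^ s) x

theorem span_pow_le_powerColon_colon {T : Type*} [CommRing T] (f : Fin d → T) {m s e j : ℕ}
    (h : d * m < j + s + e) : Ideal.span (Set.range f) ^ j ≤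
      (powerColon f (m + 1) s).colon ((Ideal.span (Set.range f) ^ e : Ideal T) : Set T) := by
  intro x hx
  rw [Submodule.mem_colon]
  intro y hy
  rw [powerColon, Submodule.mem_colon_singleton, smul_eq_mul, smul_eq_mul]
  refine span_pow_le_span_range_pow f (e := j + s + e) (by simpa using h) ?_
  rw [mul_right_comm, pow_add, pow_add]
  exact Ideal.mul_mem_mul (Ideal.mul_mem_mul hx (Ideal.pow_mem_pow
    (Ideal.sum_mem _ fun i _ => Ideal.subset_span (Set.mem_range_self i)) s)) hy

theorem powerColon_colon_span_pow (hf : IsSystemOfParameters f) {m s e j : ℕ} (hj : j ≤ m + 1)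
    (hsum : j + s + e = d * m + 1) (hse : d * m ≤ s + 2 * e) :
    (powerColon f (m + 1) s).colon
      ((Ideal.span (Set.range f) ^ e : Ideal (MvPowerSeries (Fin d) k)) : Set _) =
      Ideal.span (Set.range f) ^ j := by
  have := isAddTorsionFree_of_charZero_algebra k
    (A := MvPowerSeries (Fin d) k ⧸ Ideal.span (Set.range f))
  refine le_antisymm (fun g hg => ?_) (span_pow_le_powerColon_colon f (by omega))
  refine mem_span_pow_of_mul_mem_colon f m (hf.mem_span_of_mul_prod_pow_mem m) (s := s) (e := e) hj
    (by simpa using hsum) (by simpa using hse) fun y hy => ?_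
  have h1 := Submodule.mem_colon.1 hg y hy
  rwa [powerColon, Submodule.mem_colon_singleton, smul_eq_mul, smul_eq_mul, mul_comm] at h1

theorem isDirectlyLinkedVia_powerColon (hf : IsSystemOfParameters f) {m s e j : ℕ}
    (hj : j ≤ m + 1) (he : e ≤ m + 1) (hsum : j + s + e = d * m + 1) (hs : s ≤ d * m)
    (hse : d * m ≤ s + 2 * e) (hsj : d * m ≤ s + 2 * j) :
    IsDirectlyLinkedVia (powerColon f (m + 1) s) (Ideal.span (Set.range f) ^ e)
      (Ideal.span (Set.range f) ^ j) := by
  have h1 := hf.powerColon_colon_span_pow hj hsum hse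
  have h2 := hf.powerColon_colon_span_pow (e := j) (j := e) he (by omega) hsj
  have hle (I : Ideal (MvPowerSeries (Fin d) k)) :
      powerColon f (m + 1) s ≤ (powerColon f (m + 1) s).colon (I : Set _) :=
    fun x hx => Submodule.mem_colon.2 fun y _ => Ideal.mul_mem_right _ _ hx
  exact ⟨hf.isGorensteinIdeal_powerColon hs, h2 ▸ hle _, h1 ▸ hle _, h1, h2⟩

theorem isDirectlyLinkedVia_succ (hf : IsSystemOfParameters f) {m s : ℕ}
    (hs : (s : ℤ) = ((d : ℤ) - 2) * m) :
    IsDirectlyLinkedVia (powerColon f (m + 1) s) (Ideal.span (Set.range f) ^ (m + 1))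
      (Ideal.span (Set.range f) ^ m) := by
  have h : s + 2 * m = d * m := by
    zify
    rw [hs]
    ring
  exact hf.isDirectlyLinkedVia_powerColon (by omega) le_rfl (by omega) (by omega) (by omega)
    (by omega)

theorem isGorensteinLinkedInSteps (hf : IsSystemOfParameters f) (hd : 2 ≤ d) (m : ℕ) :
    IsGorensteinLinkedInSteps m (Ideal.span (Set.range f) ^ (m + 1)) (Ideal.span (Set.range f)) := by
  refine ⟨fun i => Ideal.span (Set.range f) ^ (m + 1 - i), by simp, by simp, fun i hi => ?_⟩
  -- The linking ideal changes with i: each step uses the powers of the fᵢ matching the current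
  -- power of D.
  refine ⟨powerColon f (m - i + 1) ((d - 2) * (m - i)), ?_⟩
  have h := hf.isDirectlyLinkedVia_succ (m := m - i) (s := (d - 2) * (m - i))
    (by rw [Nat.cast_mul, Nat.cast_sub hd, Nat.cast_ofNat])
  have e1 : m + 1 - i = m - i + 1 := by omega
  have e2 : m + 1 - (i + 1) = m - i := by omega
  simpa only [e1, e2] using h

end IsSystemOfParameters

end GorensteinLinkage

theorem proposition4 {k : Type*} [Field k] [CharZero k] (d n : ℕ) (hn : 1 ≤ n)
    (f : Fin d → MvPowerSeries (Fin d) k) (hf : IsSystemOfParameters f)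
    (D : Ideal (MvPowerSeries (Fin d) k)) (hD : D = Ideal.span (Set.range f)) :
    (∀ s : ℕ, ((d : ℤ) - 2) * ((n : ℤ) - 1) - 1 ≤ (s : ℤ) →
      ((s : ℤ) ≤ (d : ℤ) * ((n : ℤ) - 1) → IsGorensteinIdeal (powerColon f n s)) ∧
      (powerColon f n s).colon ((D ^ n : Ideal (MvPowerSeries (Fin d) k)) : Set _) =
        D ^ (((d : ℤ) - 1) * ((n : ℤ) - 1) - (s : ℤ)).toNat) ∧
    (∀ s : ℕ, (s : ℤ) = ((d : ℤ) - 2) * ((n : ℤ) - 1) →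
      IsDirectlyLinkedVia (powerColon f n s) (D ^ n) (D ^ (n - 1))) ∧
    (2 ≤ d → IsGorensteinLinkedInSteps (n - 1) (D ^ n) D) ∧
    (∀ s : ℕ, (s : ℤ) = ((d : ℤ) - 2) * ((n : ℤ) - 1) - 1 →
      IsDirectlyLinkedVia (powerColon f n s) (D ^ n) (D ^ n)) := by
  obtain ⟨m, rfl⟩ : ∃ m, n = m + 1 := ⟨n - 1, by omega⟩
  subst hD
  have hm : ((m + 1 : ℕ) : ℤ) - 1 = m := by push_cast; ring
  have e2 : ((d : ℤ) - 2) * m = (d * m : ℕ) - 2 * m := by push_cast; ring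
  have e1 : ((d : ℤ) - 1) * m = (d * m : ℕ) - m := by push_cast; ring
  have e0 : (d : ℤ) * m = (d * m : ℕ) := by push_cast; ring
  simp only [hm, Nat.add_sub_cancel]
  refine ⟨fun s hs => ⟨fun hs' => hf.isGorensteinIdeal_powerColon (by rw [e0] at hs'; omega), ?_⟩,
    fun s hs => hf.isDirectlyLinkedVia_succ hs,
    fun hd => hf.isGorensteinLinkedInSteps hd m, fun s hs => ?_⟩
  · rw [e2] at hs
    rw [e1]
    rcases Nat.le_total (s + m) (d * m) with h | h
    · exact hf.powerColon_colon_span_pow (by omega) (by omega) (by omega)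
    -- Here `toNat` truncates to 0, and D^(m+1) already lies in the colon ideal because s + m + 1 >
    -- dm.
    · have h0 : (((d * m : ℕ) : ℤ) - m - s).toNat = 0 := by omega
      rw [h0, pow_zero, Ideal.one_eq_top, eq_top_iff]
      refine le_trans ?_ (IsSystemOfParameters.span_pow_le_powerColon_colon f (j := 0) (by omega))
      simp
  · rw [e2] at hs
    exact hf.isDirectlyLinkedVia_powerColon le_rfl le_rfl (by omega) (by omega) (by omega)
      (by omega)
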